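/- Let $n\ge 1$, let $\phi:\{1,\dots,n\}\to\{1,2\}$ be a map with cluster sizes $n_a=|\phi^{-1}(a)|$ ($a=1,2$), and let $p,q\in[0,1]$. In the two-cluster $(p,q)$-stochastic block model, a random simple graph on $\{1,\dots,n\}$ is generated by connecting each pair $i<j$ independently, with probability $p$ if $\phi(i)=\phi(j)$ and with probability $q$ if $\phi(i)\ne\phi(j)$. Let $A$ be its adjacency matrix (with zero diagonal), $J$ the $n\times n$ all-ones matrix, and $X^\star$ the true partition matrix, i.e. $X^\star_{ij}=1$ if $\phi(i)=\phi(j)$ and $X^\star_{ij}=0$ otherwise. For every constant $c>0$ there is a constant $C_0>0$, depending only on $c$, such that the following holds for all $n$, $\phi$, $p$, $q$ as above. If $n_1\ge cn$, $n_2\ge cn$ and $$p-q> C_0\sqrt{\frac{p\log n}{n}},$$ then there is a (deterministic) tuning parameter $\lambda\in\mathbb{R}$ such that, with probability at least $1-10n^{-10}$, the matrix $X^\star$ is the unique optimal solution of the semidefinite program $$\max_{X\in\mathbb{R}^{n\times n}}\ \langle X, A-\lambda J\rangle\quad\text{subject to}\quad X\succeq 0,\ X_{ij}\ge 0\ \text{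 for all } i,j,\ X_{ii}=1\ \text{ for all } i,$$ where $\langle X,Y\rangle=\operatorname{trace}(X^\top Y)$ and $X\succeq 0$ means that $X$ is symmetric positive semidefinite. -/

import Mathlib

namespace SBM

open MeasureTheory ProbabilityTheory

/-- The random graph `G` on `n` nodes, defined on the probability space `(Ω, μ)`, follows the
stochastic block model with cluster map `φ` and connectivity probability matrix `B`: the events
"`i` and `j` are connected", one for each pair `i < j`, are independent, and that event has
probability `B (φ i) (φ j)`. (Graphs are simple, so that there are no self-loops.) -/
structure IsSBM {Ω : Type*} [MeasurableSpace Ω] (μ : Measure Ω) {n r : ℕ}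
    (φ : Fin n → Fin r) (B : Matrix (Fin r) (Fin r) ℝ) (G : Ω → SimpleGraph (Fin n)) : Prop where
  measurableSet_adj : ∀ i j : Fin n, i < j → MeasurableSet {ω | (G ω).Adj i j}
  prob_adj : ∀ i j : Fin n, i < j → μ.real {ω | (G ω).Adj i j} = B (φ i) (φ j)
  indep_adj : iIndepSet
    (fun e : {e : Fin n × Fin n // e.1 < e.2} => {ω | (G ω).Adj e.1.1 e.1.2}) μ

/-- The connectivity probability matrix of the `(p, q)`-model: `p` on the diagonal, `q` off it. -/
def pqMatrix (r : ℕ) (p q : ℝ) : Matrix (Fin r) (Fin r) ℝ :=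
  Matrix.of fun a b => if a = b then p else q

/-- The size `n_a` of the `a`-th cluster. -/
def clusterSize {n r : ℕ} (φ : Fin n → Fin r) (a : Fin r) : ℕ :=
  (Finset.univ.filter fun i => φ i = a).card

/-- The partition matrix of `φ`: entry `1` if the two nodes share a cluster and `0` otherwise. -/
def partitionMatrix {n r : ℕ} (φ : Fin n → Fin r) : Matrix (Fin n) (Fin n) ℝ :=
  Matrix.of fun i j => if φ i = φ j then 1 else 0

open Classical in
/-- The real adjacency matrix of a graph on `n` nodes. -/
noncomputable def adjacencyMatrix {n : ℕ} (G : SimpleGraph (Fin n)) : Matrix (Fin n) (Fin n) ℝ :=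
  G.adjMatrix ℝ

/-- The all-ones matrix `J_n`. -/
def allOnes (n : ℕ) : Matrix (Fin n) (Fin n) ℝ :=
  Matrix.of fun _ _ => 1

/-- The objective `⟨X, A - lam J⟩`, where `⟨X, Y⟩ = trace (Xᵀ Y)`. -/
def sdpObjective {n : ℕ} (A : Matrix (Fin n) (Fin n) ℝ) (lam : ℝ)
    (X : Matrix (Fin n) (Fin n) ℝ) : ℝ :=
  (X.transpose * (A - lam • allOnes n)).trace

/-- The feasible set of the relaxation: positive semidefinite (in particular symmetric) matrices
with nonnegative entries and unit diagonal. -/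
def sdpFeasible (n : ℕ) : Set (Matrix (Fin n) (Fin n) ℝ) :=
  {X | X.PosSemidef ∧ (∀ i j, 0 ≤ X i j) ∧ ∀ i, X i i = 1}

/-- `X` is a solution of the semidefinite program. -/
def IsSDPSolution {n : ℕ} (A : Matrix (Fin n) (Fin n) ℝ) (lam : ℝ)
    (X : Matrix (Fin n) (Fin n) ℝ) : Prop :=
  X ∈ sdpFeasible n ∧ ∀ Y ∈ sdpFeasible n, sdpObjective A lam Y ≤ sdpObjective A lam X

/-- `X` is the unique solution of the semidefinite program. -/
def IsUniqueSDPSolution {n : ℕ} (A : Matrix (Fin n) (Fin n) ℝ) (lam : ℝ)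
    (X : Matrix (Fin n) (Fin n) ℝ) : Prop :=
  IsSDPSolution A lam X ∧ ∀ Y, IsSDPSolution A lam Y → Y = X

end SBM

/-! Take `λ = (p + q) / 2`, let `X` be the partition matrix, `W` the centred adjacency matrix, and
`D = Y - X` for a feasible `Y`. Entries of `Y` lie in `[0, 1]`, so the sign of each `D i j` is
determined by `X`, and the objective changes by exactly `tr (W D) - (p - q) / 2 * ‖D‖₁`, with `‖D‖₁`
the entrywise norm. It suffices that the noise term is smaller than the penalty, which is
`isUniqueSDPSolution_of_noise_le`. With `P` the projection onto cluster-constant vectors and `Q = 1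
- P`, one has `D = Q Y Q + P D + D P - P D P`. The first piece costs at most `K tr (Q Y Q) = -K tr
(P D)`, where `K` bounds the largest eigenvalue of `W`, and the entries of `P` are at most the
inverse of the smallest cluster size. The other three pieces only see cluster averages of `W`.

The eigenvalue bound `K` of order `√(n p log n)` comes from a trace moment of order about `2 log n`
(`bernExp_trace_pow_le`): a discrete integration by parts replaces one factor `W` by a difference of
odd powers, which trace inequalities reduce to even powers weighted by the degree-like sums of
`|ξ_e|`, with `ξ_e` the centred edge variables; Young's inequality then absorbs half of the moment
into the left side. Cluster averages are handled by Bernstein's inequality and a union bound. The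
gap assumption forces `n p` to be at least of order `log n`, which keeps the moments of those sums
of order `n p`. -/

namespace SBM

/-! ### Trace inequalities for powers of symmetric matrices -/

section Spectral

open Matrix

variable {N : Type*} [Fintype N] [DecidableEq N]

/-- A real symmetric matrix is orthogonally diagonalisable, together with all its powers. -/
lemma exists_orthogonal_diagonalization {S : Matrix N N ℝ} (hS : Sᵀ = S) :
    ∃ (U : Matrix N N ℝ) (a : N → ℝ), U * Uᵀ = 1 ∧ Uᵀ * U = 1 ∧
      ∀ m : ℕ, S ^ m = U * diagonal (fun i => a i ^ m) * Uᵀ := by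
  have hH : S.IsHermitian := by rw [IsHermitian, conjTranspose_eq_transpose_of_trivial, hS]
  set U : Matrix N N ℝ := (hH.eigenvectorUnitary : Matrix N N ℝ) with hU
  have h1 : U * Uᵀ = 1 := by
    have := Unitary.coe_mul_star_self hH.eigenvectorUnitary
    rwa [Unitary.coe_star, star_eq_conjTranspose, conjTranspose_eq_transpose_of_trivial] at this
  have h2 : Uᵀ * U = 1 := mul_eq_one_comm.mp h1
  obtain ⟨a, h3⟩ : ∃ a : N → ℝ, S = U * diagonal a * Uᵀ := by
    refine ⟨hH.eigenvalues, ?_⟩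
    have := hH.spectral_theorem
    rw [Unitary.conjStarAlgAut_apply, star_eq_conjTranspose,
      conjTranspose_eq_transpose_of_trivial] at this
    exact this
  refine ⟨U, a, h1, h2, fun m => ?_⟩
  induction m with
  | zero => simp [h1]
  | succ m ih =>
    rw [pow_succ, ih]
    conv_lhs => rw [h3]
    calc _ = U * diagonal (fun i => a i ^ m) * (Uᵀ * U) *
          diagonal a * Uᵀ := by simp only [Matrix.mul_assoc]
      _ = _ := by
        rw [h2, Matrix.mul_one, Matrix.mul_assoc U, diagonal_mul_diagonal]
        simp only [pow_succ]

lemma trace_mul_conj_diagonal (M V : Matrix N N ℝ) (b : N → ℝ) :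
    (M * (V * diagonal b * Vᵀ)).trace = ∑ j, b j * (Vᵀ * M * V) j j := by
  rw [Matrix.mul_assoc V, ← Matrix.mul_assoc M, Matrix.trace_mul_comm, Matrix.mul_assoc,
    ← Matrix.mul_assoc Vᵀ, trace]
  simp [diagonal_mul]

lemma conj_diagonal_apply_self (U : Matrix N N ℝ) (b : N → ℝ) (i : N) :
    (U * diagonal b * Uᵀ) i i = ∑ l, U i l ^ 2 * b l := by
  rw [mul_apply]
  refine Finset.sum_congr rfl fun l _ => ?_
  rw [mul_diagonal, transpose_apply]; ring

lemma sum_sq_row_eq_one {U : Matrix N N ℝ} (hU : U * Uᵀ = 1) (i : N) :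
    ∑ l, U i l ^ 2 = 1 := by
  have := congrFun (congrFun hU i) i
  rw [mul_apply, one_apply_eq] at this
  simpa [sq] using this

/-- For nonnegative `u`, `v` the factors of `(u ^ q - v ^ q) * (u ^ r - v ^ r)` have the same sign.
Evenness of `m` reduces real arguments to their absolute values. -/
lemma pow_mul_pow_add_le (x y : ℝ) {q r m : ℕ} (hm : Even m) (hqr : q + r = m) :
    x ^ q * y ^ r + x ^ r * y ^ q ≤ x ^ m + y ^ m := by
  have key : ∀ u v : ℝ, 0 ≤ u → 0 ≤ v → u ^ q * v ^ r + u ^ r * v ^ q ≤ u ^ m + v ^ m := by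
    intro u v hu hv
    subst hqr
    have : 0 ≤ (u ^ q - v ^ q) * (u ^ r - v ^ r) := by
      rcases le_total u v with h | h
      · exact mul_nonneg_of_nonpos_of_nonpos
          (sub_nonpos.2 (pow_le_pow_left₀ hu h _)) (sub_nonpos.2 (pow_le_pow_left₀ hu h _))
      · exact mul_nonneg (sub_nonneg.2 (pow_le_pow_left₀ hv h _))
          (sub_nonneg.2 (pow_le_pow_left₀ hv h _))
    rw [pow_add, pow_add]; nlinarith
  have h := key |x| |y| (abs_nonneg x) (abs_nonneg y)
  rw [hm.pow_abs, hm.pow_abs] at h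
  refine le_trans ?_ h
  rw [← abs_pow, ← abs_pow, ← abs_pow, ← abs_pow, ← abs_mul, ← abs_mul]
  exact add_le_add (le_abs_self _) (le_abs_self _)

/-- In eigenbases `U` of `A` and `V` of `B`, each trace is a sum over pairs of eigenvalues with the
nonnegative weights `(Uᵀ H V) i j ^ 2`, so the scalar inequality applies term by term. -/
lemma trace_mul_pow_mul_pow_add_le {A B H : Matrix N N ℝ} (hA : Aᵀ = A) (hB : Bᵀ = B)
    (hH : Hᵀ = H) {q r m : ℕ} (hm : Even m) (hqr : q + r = m) :
    (H * A ^ q * H * B ^ r).trace + (H * A ^ r * H * B ^ q).trace ≤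
      (H * H * (A ^ m + B ^ m)).trace := by
  obtain ⟨U, a, hU1, hU2, hUa⟩ := exists_orthogonal_diagonalization hA
  obtain ⟨V, b, hV1, hV2, hVb⟩ := exists_orthogonal_diagonalization hB
  set M := Uᵀ * H * V with hM
  have hMt : Mᵀ = Vᵀ * H * U := by
    rw [hM, transpose_mul, transpose_mul, hH, transpose_transpose, Matrix.mul_assoc]
  have main : ∀ q r : ℕ, (H * A ^ q * H * B ^ r).trace =
      ∑ j, ∑ i, M i j ^ 2 * (a i ^ q * b j ^ r) := by
    intro q r
    rw [hUa, hVb, trace_mul_conj_diagonal]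
    refine Finset.sum_congr rfl fun j _ => ?_
    have : Vᵀ * (H * (U * diagonal (fun i => a i ^ q) * Uᵀ) * H) * V =
        Mᵀ * diagonal (fun i => a i ^ q) * Mᵀᵀ := by
      rw [hMt, transpose_mul, transpose_mul, hH, transpose_transpose]
      simp only [Matrix.mul_assoc]
    rw [this, conj_diagonal_apply_self, Finset.mul_sum]
    refine Finset.sum_congr rfl fun i _ => ?_
    rw [transpose_apply]; ring
  have e1 : (H * H * A ^ m).trace = (H * A ^ m * H * B ^ 0).trace := by
    rw [pow_zero, Matrix.mul_one, Matrix.trace_mul_comm (H * A ^ m) H, Matrix.mul_assoc]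
  have e2 : (H * H * B ^ m).trace = (H * A ^ 0 * H * B ^ m).trace := by
    rw [pow_zero, Matrix.mul_one]
  rw [Matrix.mul_add, trace_add, e1, e2, main, main, main, main, ← Finset.sum_add_distrib,
    ← Finset.sum_add_distrib]
  refine Finset.sum_le_sum fun j _ => ?_
  rw [← Finset.sum_add_distrib, ← Finset.sum_add_distrib]
  refine Finset.sum_le_sum fun i _ => ?_
  have := mul_le_mul_of_nonneg_left (pow_mul_pow_add_le (a i) (b j) hm hqr) (sq_nonneg (M i j))
  simp only [pow_zero, mul_one, one_mul]
  linarith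

lemma pow_succ_sub_pow_succ {R : Type*} [Ring R] (A B : R) (m : ℕ) :
    A ^ (m + 1) - B ^ (m + 1) = ∑ q ∈ Finset.range (m + 1), A ^ q * (A - B) * B ^ (m - q) := by
  induction m with
  | zero => simp
  | succ m ih =>
    rw [Finset.sum_range_succ, Nat.sub_self, pow_zero, mul_one]
    have : ∑ q ∈ Finset.range (m + 1), A ^ q * (A - B) * B ^ (m + 1 - q) =
        (∑ q ∈ Finset.range (m + 1), A ^ q * (A - B) * B ^ (m - q)) * B := by
      rw [Finset.sum_mul]
      refine Finset.sum_congr rfl fun q hq => ?_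
      rw [Nat.succ_sub (Nat.lt_succ_iff.1 (Finset.mem_range.1 hq)), pow_succ]
      simp only [mul_assoc]
    rw [this, ← ih, pow_succ A (m + 1), pow_succ B (m + 1)]
    noncomm_ring

/-- The telescoping sum for the difference of powers is averaged with its reflection `q ↦ m - q`.
Each of the `m + 1` resulting pairs is controlled by the previous trace inequality, and the
averaging gives the factor `1 / 2`. -/
lemma trace_mul_pow_sub_pow_le {A B H : Matrix N N ℝ} (hA : Aᵀ = A) (hB : Bᵀ = B)
    (hH : Hᵀ = H) (hAB : A - B = H) {m : ℕ} (hm : Even m) :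
    (H * (A ^ (m + 1) - B ^ (m + 1))).trace ≤
      ((m : ℝ) + 1) / 2 * (H * H * (A ^ m + B ^ m)).trace := by
  have e1 : (H * (A ^ (m + 1) - B ^ (m + 1))).trace =
      ∑ q ∈ Finset.range (m + 1), (H * A ^ q * H * B ^ (m - q)).trace := by
    rw [pow_succ_sub_pow_succ, hAB, Finset.mul_sum, trace_sum]
    refine Finset.sum_congr rfl fun q _ => ?_
    simp only [Matrix.mul_assoc]
  have e2 : (H * (A ^ (m + 1) - B ^ (m + 1))).trace =
      ∑ q ∈ Finset.range (m + 1), (H * A ^ (m - q) * H * B ^ q).trace := by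
    rw [e1, ← Finset.sum_range_reflect]
    refine Finset.sum_congr rfl fun q hq => ?_
    have := Finset.mem_range.1 hq
    rw [show m + 1 - 1 - q = m - q by omega, show m - (m - q) = q by omega]
  have h : ∑ q ∈ Finset.range (m + 1), ((H * A ^ q * H * B ^ (m - q)).trace +
      (H * A ^ (m - q) * H * B ^ q).trace) ≤
      ∑ _q ∈ Finset.range (m + 1), (H * H * (A ^ m + B ^ m)).trace := by
    refine Finset.sum_le_sum fun q hq => ?_
    have := Finset.mem_range.1 hq
    exact trace_mul_pow_mul_pow_add_le hA hB hH hm (by omega)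
  rw [Finset.sum_add_distrib, ← e1, ← e2, Finset.sum_const, Finset.card_range, nsmul_eq_mul] at h
  push_cast at h
  linarith

/-- Young's inequality for the diagonal entries of the even powers of a symmetric matrix. -/
lemma mul_pow_apply_self_le {S : Matrix N N ℝ} (hS : Sᵀ = S) (i : N) {c : ℝ} (hc : 0 ≤ c)
    (k : ℕ) :
    c * (S ^ (2 * k)) i i ≤ 1 / 2 * (S ^ (2 * (k + 1))) i i + 1 / 2 * (2 * c) ^ (k + 1) := by
  obtain ⟨U, a, hU1, hU2, hUa⟩ := exists_orthogonal_diagonalization hS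
  -- The coefficient `1 / 2` is what later allows absorption into the left side; the two regimes
  -- meet at `x = 2 * c`. The scalar bound is then averaged over squared eigenvalues with the
  -- weights `U i l ^ 2`, which sum to one.
  have key : ∀ x : ℝ, 0 ≤ x → c * x ^ k ≤ 1 / 2 * x ^ (k + 1) + 1 / 2 * (2 * c) ^ (k + 1) := by
    intro x hx
    rcases le_total (2 * c) x with h | h
    · have h1 : 0 ≤ (2 * c) ^ (k + 1) := by positivity
      have h2 : 2 * c * x ^ k ≤ x * x ^ k := mul_le_mul_of_nonneg_right h (by positivity)
      rw [pow_succ' x]; linarith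
    · have h1 : 0 ≤ x ^ (k + 1) := by positivity
      have h2 : c * x ^ k ≤ c * (2 * c) ^ k := by gcongr
      rw [pow_succ' (2 * c)]; linarith
  have hone : 1 / 2 * (2 * c) ^ (k + 1) = ∑ l, 1 / 2 * (2 * c) ^ (k + 1) * U i l ^ 2 := by
    rw [← Finset.mul_sum, sum_sq_row_eq_one hU1 i, mul_one]
  rw [hUa, hUa, conj_diagonal_apply_self, conj_diagonal_apply_self, Finset.mul_sum, Finset.mul_sum,
    hone, ← Finset.sum_add_distrib]
  refine Finset.sum_le_sum fun l _ => ?_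
  have := mul_le_mul_of_nonneg_left (key (a l ^ 2) (sq_nonneg _)) (sq_nonneg (U i l))
  rw [pow_mul, pow_mul]
  linarith

lemma trace_pow_two_mul_nonneg {S : Matrix N N ℝ} (hS : Sᵀ = S) (k : ℕ) :
    0 ≤ (S ^ (2 * k)).trace := by
  obtain ⟨U, a, hU1, hU2, hUa⟩ := exists_orthogonal_diagonalization hS
  refine Finset.sum_nonneg fun i _ => ?_
  rw [diag_apply, hUa, conj_diagonal_apply_self]
  refine Finset.sum_nonneg fun l _ => ?_
  rw [pow_mul]; positivity

/-- The trace of an even power controls the largest eigenvalue. -/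
lemma posSemidef_smul_one_sub {S : Matrix N N ℝ} (hS : Sᵀ = S) {K : ℝ} (hK : 0 ≤ K) {k : ℕ}
    (hk : k ≠ 0) (h : (S ^ (2 * k)).trace ≤ K ^ (2 * k)) : (K • 1 - S).PosSemidef := by
  obtain ⟨U, a, hU1, hU2, hUa⟩ := exists_orthogonal_diagonalization hS
  have htr : (S ^ (2 * k)).trace = ∑ l, a l ^ (2 * k) := by
    rw [hUa, Matrix.trace_mul_comm, ← Matrix.mul_assoc, hU2, Matrix.one_mul, trace_diagonal]
  have ha : ∀ l, a l ≤ K := by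
    intro l
    have h1 : a l ^ (2 * k) ≤ K ^ (2 * k) := by
      refine le_trans ?_ (htr ▸ h)
      exact Finset.single_le_sum (f := fun l => a l ^ (2 * k))
        (fun i _ => by rw [pow_mul]; positivity) (Finset.mem_univ l)
    rw [← (even_two_mul k).pow_abs] at h1
    exact (le_abs_self _).trans (le_of_pow_le_pow_left₀ (by omega) hK h1)
  have hS' : S = U * diagonal a * Uᵀ := by simpa using hUa 1
  have : K • (1 : Matrix N N ℝ) - S = U * diagonal (fun l => K - a l) * Uᴴ := by
    rw [conjTranspose_eq_transpose_of_trivial, ← diagonal_sub, Matrix.mul_sub, Matrix.sub_mul,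
      ← hS', ← smul_one_eq_diagonal, Matrix.mul_smul, Matrix.smul_mul, Matrix.mul_one, hU1]
  rw [this]
  exact (posSemidef_diagonal_iff.2 fun l => sub_nonneg.2 (ha l)).mul_mul_conjTranspose_same U

end Spectral

/-! ### Moments of independent Bernoulli variables on the finite cube -/

section Bernoulli

variable {ι : Type*} {p : ι → ℝ}

/-- The centred value of the `e`-th Bernoulli variable. -/
def centred (p : ι → ℝ) (x : ι → Bool) (e : ι) : ℝ := cond (x e) (1 - p e) (- p e)

/-- The absolute value of the centred value of the `e`-th Bernoulli variable. -/
def absCentred (p : ι → ℝ) (x : ι → Bool) (e : ι) : ℝ := cond (x e) (1 - p e) (p e)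

lemma absCentred_nonneg (h0 : ∀ e, 0 ≤ p e) (h1 : ∀ e, p e ≤ 1) (x : ι → Bool) (e : ι) :
    0 ≤ absCentred p x e := by
  unfold absCentred
  cases x e
  · exact h0 e
  · exact sub_nonneg.2 (h1 e)

variable [Fintype ι]

/-- The probability of the configuration `x` under independent Bernoulli variables with success
probabilities `p`. -/
def bernWeight (p : ι → ℝ) (x : ι → Bool) : ℝ := ∏ e, cond (x e) (p e) (1 - p e)

lemma bernWeight_nonneg (h0 : ∀ e, 0 ≤ p e) (h1 : ∀ e, p e ≤ 1) (x : ι → Bool) :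
    0 ≤ bernWeight p x := by
  refine Finset.prod_nonneg fun e _ => ?_
  cases x e
  · exact sub_nonneg.2 (h1 e)
  · exact h0 e

variable [DecidableEq ι]

/-- Expectation with respect to independent Bernoulli variables with success probabilities `p`. -/
def bernExp (p : ι → ℝ) (f : (ι → Bool) → ℝ) : ℝ := ∑ x, bernWeight p x * f x

lemma bernExp_mono (h0 : ∀ e, 0 ≤ p e) (h1 : ∀ e, p e ≤ 1) {f g : (ι → Bool) → ℝ}
    (h : ∀ x, f x ≤ g x) : bernExp p f ≤ bernExp p g :=
  Finset.sum_le_sum fun x _ => mul_le_mul_of_nonneg_left (h x) (bernWeight_nonneg h0 h1 x)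

lemma bernExp_add (f g : (ι → Bool) → ℝ) :
    bernExp p (fun x => f x + g x) = bernExp p f + bernExp p g := by
  simp only [bernExp, mul_add, Finset.sum_add_distrib]

lemma bernExp_const_mul (c : ℝ) (f : (ι → Bool) → ℝ) :
    bernExp p (fun x => c * f x) = c * bernExp p f := by
  simp only [bernExp, Finset.mul_sum]
  exact Finset.sum_congr rfl fun x _ => by ring

lemma bernExp_sum {κ : Type*} (s : Finset κ) (f : κ → (ι → Bool) → ℝ) :
    bernExp p (fun x => ∑ j ∈ s, f j x) = ∑ j ∈ s, bernExp p (f j) := by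
  simp only [bernExp, Finset.mul_sum]
  exact Finset.sum_comm

lemma bernExp_prod (f : ι → Bool → ℝ) :
    bernExp p (fun x => ∏ e, f e (x e)) =
      ∏ e, (p e * f e true + (1 - p e) * f e false) := by
  have : ∀ e, p e * f e true + (1 - p e) * f e false =
      ∑ b : Bool, cond b (p e) (1 - p e) * f e b := fun e => by simp
  simp only [this, bernExp, bernWeight, Finset.prod_univ_sum, Fintype.piFinset_univ,
    Finset.prod_mul_distrib]

/-- Resampling one coordinate. -/
lemma bernExp_update (e : ι) (f : (ι → Bool) → ℝ) :
    bernExp p f = bernExp p (fun x => p e * f (Function.update x e true) +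
      (1 - p e) * f (Function.update x e false)) := by
  -- Swapping coordinate `e` of `x` with an independent fresh bit is an involution that preserves
  -- the product weight.
  have hσ : Function.Involutive
      (fun y : (ι → Bool) × Bool => (Function.update y.1 e y.2, y.1 e)) := by
    rintro ⟨x, b⟩; simp
  have hw : ∀ (x : ι → Bool) (b : Bool),
      bernWeight p (Function.update x e b) * cond (x e) (p e) (1 - p e) =
        bernWeight p x * cond b (p e) (1 - p e) := by
    intro x b
    simp only [bernWeight, ← Finset.mul_prod_erase Finset.univ _ (Finset.mem_univ e)]
    have : ∏ j ∈ Finset.univ.erase e, cond (Function.update x e b j) (p j) (1 - p j) =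
        ∏ j ∈ Finset.univ.erase e, cond (x j) (p j) (1 - p j) :=
      Finset.prod_congr rfl fun j hj => by
        rw [Function.update_of_ne (Finset.ne_of_mem_erase hj)]
    rw [this, Function.update_self]; ring
  have h1 : bernExp p f =
      ∑ y : (ι → Bool) × Bool, bernWeight p y.1 * cond y.2 (p e) (1 - p e) * f y.1 := by
    rw [Fintype.sum_prod_type]
    refine Finset.sum_congr rfl fun x _ => ?_
    simp only [Fintype.sum_bool, cond_true, cond_false]; ring
  rw [h1, ← Equiv.sum_comp hσ.toPerm, Fintype.sum_prod_type]
  refine Finset.sum_congr rfl fun x _ => ?_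
  simp only [Function.Involutive.coe_toPerm, hw, Fintype.sum_bool, cond_true, cond_false]
  ring

/-- A discrete integration by parts. -/
lemma bernExp_centred_mul (e : ι) (g : (ι → Bool) → ℝ) :
    bernExp p (fun x => centred p x e * g x) = bernExp p (fun x => p e * (1 - p e) *
      (g (Function.update x e true) - g (Function.update x e false))) := by
  rw [bernExp_update e]
  congr 1; funext x
  simp only [centred, Function.update_self, cond_true, cond_false]; ring

lemma bernExp_absCentred_mul (e : ι) (g : (ι → Bool) → ℝ) :
    bernExp p (fun x => absCentred p x e * g x) = bernExp p (fun x => p e * (1 - p e) *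
      (g (Function.update x e true) + g (Function.update x e false))) := by
  rw [bernExp_update e]
  congr 1; funext x
  simp only [absCentred, Function.update_self, cond_true, cond_false]; ring

/-- Bernstein's bound for the moment generating function. -/
lemma bernExp_exp_centred_le (h0 : ∀ e, 0 ≤ p e) (h1 : ∀ e, p e ≤ 1) {r : ι → ℝ}
    (hr0 : ∀ e, 0 ≤ r e) (hr1 : ∀ e, r e ≤ 1) {θ : ℝ} (hθ : |θ| ≤ 1) {P : ℝ}
    (hP : ∀ e, p e ≤ P) :
    bernExp p (fun x => Real.exp (θ * ∑ e, r e * centred p x e)) ≤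
      Real.exp (θ ^ 2 * P * ∑ e, r e) := by
  have e1 : ∀ x : ι → Bool, Real.exp (θ * ∑ e, r e * centred p x e) =
      ∏ e, (fun e b => Real.exp (θ * r e * cond b (1 - p e) (- p e))) e (x e) := by
    intro x
    rw [Finset.mul_sum, Real.exp_sum]
    exact Finset.prod_congr rfl fun e _ => by simp only [centred, mul_assoc]
  rw [funext e1, bernExp_prod (fun e b => Real.exp (θ * r e * cond b (1 - p e) (- p e))), Finset.mul_sum, Real.exp_sum]
  refine Finset.prod_le_prod (fun e _ => ?_) fun e _ => ?_
  · have := sub_nonneg.2 (h1 e)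
    have := h0 e
    positivity
  have key : ∀ y : ℝ, |y| ≤ 1 → Real.exp y ≤ 1 + y + y ^ 2 := fun y hy => by
    linarith [(abs_le.1 (Real.abs_exp_sub_one_sub_id_le hy)).2]
  have hb : ∀ z : ℝ, |z| ≤ 1 → |θ * r e * z| ≤ 1 := fun z hz => by
    rw [abs_mul, abs_mul, abs_of_nonneg (hr0 e)]
    exact mul_le_one₀ (mul_le_one₀ hθ (hr0 e) (hr1 e)) (abs_nonneg _) hz
  have p0 := h0 e
  have p1 := sub_nonneg.2 (h1 e)
  have k1 := key _ (hb (1 - p e) (abs_le.2 ⟨by linarith, by linarith⟩))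
  have k2 := key _ (hb (- p e) (abs_le.2 ⟨by linarith, by linarith⟩))
  have k1' := mul_le_mul_of_nonneg_left k1 p0
  have k2' := mul_le_mul_of_nonneg_left k2 p1
  -- The linear term of `exp y ≤ 1 + y + y ^ 2` vanishes by centring, and `r e ^ 2 ≤ r e` makes the
  -- variance term linear in `r`.
  have k3 : r e ^ 2 * (p e * (1 - p e)) ≤ r e * P := by
    have a1 : r e ^ 2 ≤ r e := by nlinarith [hr0 e, hr1 e]
    have a2 : p e * (1 - p e) ≤ P := by nlinarith [hP e]
    exact mul_le_mul a1 a2 (mul_nonneg p0 p1) (hr0 e)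
  have k4 := mul_le_mul_of_nonneg_left k3 (sq_nonneg θ)
  simp only [cond_true, cond_false]
  calc _ ≤ θ ^ 2 * (r e ^ 2 * (p e * (1 - p e))) + 1 := by nlinarith
    _ ≤ θ ^ 2 * P * r e + 1 := by linarith
    _ ≤ _ := Real.add_one_le_exp _

/-- On `[0, 1]` one has `exp y ≤ 1 + 2 * y`, and the mean of the absolute centred variable is `2 * p
e * (1 - p e)`; together these give the constant `4`. -/
lemma bernExp_exp_absCentred_le (h0 : ∀ e, 0 ≤ p e) (h1 : ∀ e, p e ≤ 1) {r : ι → ℝ}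
    (hr0 : ∀ e, 0 ≤ r e) (hr1 : ∀ e, r e ≤ 1) {θ : ℝ} (hθ0 : 0 ≤ θ) (hθ : θ ≤ 1) {P : ℝ}
    (hP : ∀ e, p e ≤ P) :
    bernExp p (fun x => Real.exp (θ * ∑ e, r e * absCentred p x e)) ≤
      Real.exp (4 * θ * P * ∑ e, r e) := by
  have e1 : ∀ x : ι → Bool, Real.exp (θ * ∑ e, r e * absCentred p x e) =
      ∏ e, (fun e b => Real.exp (θ * r e * cond b (1 - p e) (p e))) e (x e) := by
    intro x
    rw [Finset.mul_sum, Real.exp_sum]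
    exact Finset.prod_congr rfl fun e _ => by simp only [absCentred, mul_assoc]
  rw [funext e1, bernExp_prod (fun e b => Real.exp (θ * r e * cond b (1 - p e) (p e))), Finset.mul_sum, Real.exp_sum]
  refine Finset.prod_le_prod (fun e _ => ?_) fun e _ => ?_
  · have := sub_nonneg.2 (h1 e)
    have := h0 e
    positivity
  have p0 := h0 e
  have p1 := sub_nonneg.2 (h1 e)
  have hθr : 0 ≤ θ * r e := mul_nonneg hθ0 (hr0 e)
  have key : ∀ z : ℝ, 0 ≤ z → z ≤ 1 → Real.exp (θ * r e * z) ≤ 1 + 2 * (θ * r e * z) := by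
    intro z hz hz1
    have hy0 : 0 ≤ θ * r e * z := mul_nonneg hθr hz
    have hy1 : θ * r e * z ≤ 1 := mul_le_one₀ (mul_le_one₀ hθ (hr0 e) (hr1 e)) hz hz1
    have := (abs_le.1 (Real.abs_exp_sub_one_sub_id_le (abs_le.2 ⟨by linarith, hy1⟩))).2
    nlinarith
  have k1 := mul_le_mul_of_nonneg_left (key _ p1 (by linarith)) p0
  have k2 := mul_le_mul_of_nonneg_left (key _ p0 (by linarith)) p1
  have k3 : p e * (1 - p e) ≤ P := by nlinarith [hP e]
  have k4 := mul_le_mul_of_nonneg_left k3 hθr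
  simp only [cond_true, cond_false]
  calc _ ≤ 4 * (θ * r e * (p e * (1 - p e))) + 1 := by nlinarith
    _ ≤ 4 * θ * P * r e + 1 := by linarith
    _ ≤ _ := Real.add_one_le_exp _

/-- Moments of a weighted sum of absolute values of centred Bernoulli variables. -/
lemma bernExp_sum_absCentred_pow_le (h0 : ∀ e, 0 ≤ p e) (h1 : ∀ e, p e ≤ 1) {r : ι → ℝ}
    (hr0 : ∀ e, 0 ≤ r e) (hr1 : ∀ e, r e ≤ 1) {P D : ℝ} (hP : ∀ e, p e ≤ P) (hP0 : 0 ≤ P)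
    (hD : ∑ e, r e ≤ D) {k : ℕ} (hk : (k : ℝ) ≤ D * P) (hDP : 0 < D * P) :
    bernExp p (fun x => (∑ e, r e * absCentred p x e) ^ k) ≤ (D * P * Real.exp 4) ^ k := by
  set M := D * P with hM
  -- From `t ≤ exp t` at `t = d / M`, raised to the power `k`. The exponential moment is then needed
  -- at `θ = k / M`, which is at most `1` by `hk`.
  have e1 : ∀ x : ι → Bool, (∑ e, r e * absCentred p x e) ^ k ≤
      M ^ k * Real.exp ((k / M) * ∑ e, r e * absCentred p x e) := by
    intro x
    set d := ∑ e, r e * absCentred p x e with hd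
    have hd0 : 0 ≤ d := Finset.sum_nonneg fun e _ => mul_nonneg (hr0 e) (absCentred_nonneg h0 h1 x e)
    have h2 : d / M ≤ Real.exp (d / M) := by linarith [Real.add_one_le_exp (d / M)]
    have h3 := pow_le_pow_left₀ (by positivity) h2 k
    rw [← Real.exp_nat_mul, div_pow, div_le_iff₀ (by positivity)] at h3
    calc d ^ k ≤ _ := h3
      _ = _ := by rw [mul_comm]; congr 2; ring
  refine (bernExp_mono h0 h1 e1).trans ?_
  rw [bernExp_const_mul, mul_pow M]
  refine mul_le_mul_of_nonneg_left ?_ (pow_nonneg hDP.le k)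
  refine (bernExp_exp_absCentred_le h0 h1 hr0 hr1 (div_nonneg k.cast_nonneg hDP.le)
    ((div_le_one hDP).2 hk) hP).trans ?_
  rw [← Real.exp_nat_mul, Real.exp_le_exp]
  have : P * ∑ e, r e ≤ M := by rw [hM, mul_comm D]; exact mul_le_mul_of_nonneg_left hD hP0
  calc 4 * (k / M) * P * ∑ e, r e = 4 * (k / M) * (P * ∑ e, r e) := by ring
    _ ≤ 4 * (k / M) * M := mul_le_mul_of_nonneg_left this (by positivity)
    _ = k * 4 := by field_simp

/-- Markov's inequality. -/
lemma bernExp_indicator_le (h0 : ∀ e, 0 ≤ p e) (h1 : ∀ e, p e ≤ 1) {f : (ι → Bool) → ℝ}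
    (hf : ∀ x, 0 ≤ f x) {t : ℝ} (ht : 0 < t) {B : Set (ι → Bool)} (hB : ∀ x ∈ B, t ≤ f x) :
    bernExp p (B.indicator fun _ => (1 : ℝ)) ≤ bernExp p f / t := by
  rw [le_div_iff₀ ht, mul_comm, ← bernExp_const_mul]
  refine bernExp_mono h0 h1 fun x => ?_
  by_cases hx : x ∈ B
  · simpa [hx] using hB x hx
  · simpa [hx] using hf x

open Matrix

variable {N : Type*} [Fintype N] [DecidableEq N]

/-- A moment inequality of Khintchine type for a sum of independent centred Bernoulli variables with
symmetric matrix coefficients whose squares are diagonal. -/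
theorem bernExp_trace_pow_le (h0 : ∀ e, 0 ≤ p e) (h1 : ∀ e, p e ≤ 1) {H : ι → Matrix N N ℝ}
    (hH : ∀ e, (H e)ᵀ = H e) {r : ι → N → ℝ} (hr0 : ∀ e i, 0 ≤ r e i)
    (hHr : ∀ e, H e * H e = diagonal (r e)) (k : ℕ) :
    bernExp p (fun x => ((∑ e, centred p x e • H e) ^ (2 * (k + 1))).trace) ≤
      ∑ i, bernExp p (fun x =>
        (2 * (k + 1) * ∑ e, r e i * absCentred p x e) ^ (k + 1)) := by
  set S : (ι → Bool) → Matrix N N ℝ := fun x => ∑ e, centred p x e • H e with hS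
  have hSt : ∀ x, (S x)ᵀ = S x := fun x => by
    simp only [hS, transpose_sum, transpose_smul, hH]
  have hSd : ∀ x e, S (Function.update x e true) - S (Function.update x e false) = H e := by
    intro x e
    simp only [hS]
    rw [← Finset.sum_sub_distrib, Finset.sum_eq_single e]
    · simp [centred, ← add_smul]
    · intro j _ hj
      simp [centred, Function.update_of_ne hj]
    · simp
  have step1 : bernExp p (fun x => (S x ^ (2 * (k + 1))).trace) =
      ∑ e, bernExp p (fun x => centred p x e * (H e * S x ^ (2 * k + 1)).trace) := by
    rw [← bernExp_sum]
    congr 1; funext x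
    rw [show 2 * (k + 1) = (2 * k + 1) + 1 by ring, pow_succ']
    conv_lhs => enter [1, 1]; rw [hS]
    simp only [Finset.sum_mul, trace_sum, Matrix.smul_mul, trace_smul, smul_eq_mul]
  -- Integration by parts leaves the difference of odd powers at the two values of coordinate `e`.
  -- The trace inequality bounds it by a sum of even powers at those values, and
  -- `bernExp_absCentred_mul` folds that sum back into one expectation at `x`.
  have step2 : ∀ e, bernExp p (fun x => centred p x e * (H e * S x ^ (2 * k + 1)).trace) ≤
      bernExp p (fun x => absCentred p x e *
        (((2 * k : ℝ) + 1) / 2 * (H e * H e * S x ^ (2 * k)).trace)) := by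
    intro e
    rw [bernExp_centred_mul, bernExp_absCentred_mul]
    refine bernExp_mono h0 h1 fun x => ?_
    refine mul_le_mul_of_nonneg_left ?_ (mul_nonneg (h0 e) (sub_nonneg.2 (h1 e)))
    have := trace_mul_pow_sub_pow_le (hSt (Function.update x e true))
      (hSt (Function.update x e false)) (hH e) (hSd x e) (even_two_mul k)
    rw [Matrix.mul_sub, trace_sub, Matrix.mul_add, trace_add] at this
    push_cast at this
    linarith
  -- As `H e * H e` is diagonal, only diagonal entries of `S x ^ (2 * k)` occur, and Young's
  -- inequality applies to each. Half of the moment being estimated reappears on the right and is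
  -- absorbed at the end.
  have step3 : ∀ x, ∑ e, absCentred p x e *
        (((2 * k : ℝ) + 1) / 2 * (H e * H e * S x ^ (2 * k)).trace) ≤
      1 / 2 * (S x ^ (2 * (k + 1))).trace +
        1 / 2 * ∑ i, (2 * (k + 1) * ∑ e, r e i * absCentred p x e) ^ (k + 1) := by
    intro x
    have e1 : ∑ e, absCentred p x e *
        (((2 * k : ℝ) + 1) / 2 * (H e * H e * S x ^ (2 * k)).trace) =
        ∑ i, (((2 * k : ℝ) + 1) / 2 * ∑ e, r e i * absCentred p x e) * (S x ^ (2 * k)) i i := by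
      simp only [hHr, trace, diag_apply, diagonal_mul, Finset.mul_sum, Finset.sum_mul]
      rw [Finset.sum_comm]
      exact Finset.sum_congr rfl fun i _ => Finset.sum_congr rfl fun e _ => by ring
    rw [e1, trace, Finset.mul_sum, Finset.mul_sum, ← Finset.sum_add_distrib]
    refine Finset.sum_le_sum fun i _ => ?_
    have hd : 0 ≤ ∑ e, r e i * absCentred p x e :=
      Finset.sum_nonneg fun e _ => mul_nonneg (hr0 e i) (absCentred_nonneg h0 h1 x e)
    refine (mul_pow_apply_self_le (hSt x) i (by positivity) k).trans ?_
    rw [diag_apply]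
    refine add_le_add le_rfl (mul_le_mul_of_nonneg_left
      (pow_le_pow_left₀ (by positivity) ?_ _) (by norm_num))
    rw [← mul_assoc]
    exact mul_le_mul_of_nonneg_right (by linarith) hd
  have step4 := (Finset.sum_le_sum fun e (_ : e ∈ Finset.univ) => step2 e)
  rw [← step1, ← bernExp_sum] at step4
  have step5 := step4.trans (bernExp_mono h0 h1 step3)
  rw [bernExp_add, bernExp_const_mul, bernExp_const_mul, bernExp_sum] at step5
  linarith

end Bernoulli

/-! ### Deterministic condition for exact recovery -/

section Certificate

open Matrix

lemma sdpObjective_eq_sum {n : ℕ} (A : Matrix (Fin n) (Fin n) ℝ) (lam : ℝ)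
    (X : Matrix (Fin n) (Fin n) ℝ) :
    sdpObjective A lam X = ∑ i, ∑ j, X i j * (A i j - lam) := by
  rw [sdpObjective, trace, Finset.sum_comm]
  refine Finset.sum_congr rfl fun j _ => ?_
  rw [diag_apply, mul_apply]
  exact Finset.sum_congr rfl fun i _ => by simp [allOnes]

/-- Positive semidefiniteness is tested on the difference of two basis vectors. -/
lemma le_one_of_mem_sdpFeasible {n : ℕ} {Y : Matrix (Fin n) (Fin n) ℝ} (hY : Y ∈ sdpFeasible n)
    (i j : Fin n) : Y i j ≤ 1 := by
  obtain ⟨hP, -, hd⟩ := hY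
  have h := hP.dotProduct_mulVec_nonneg (Pi.single i 1 - Pi.single j 1)
  have hs : Y j i = Y i j := by simpa using congrFun (congrFun hP.1 i) j
  simp [sub_dotProduct, mulVec_sub, hd, hs] at h
  linarith

lemma partitionMatrix_mem_sdpFeasible {n r : ℕ} (φ : Fin n → Fin r) :
    partitionMatrix φ ∈ sdpFeasible n := by
  refine ⟨?_, fun i j => ?_, fun i => by simp [partitionMatrix]⟩
  · have : partitionMatrix φ = (of fun i a => if φ i = a then (1 : ℝ) else 0) *
        (of fun i a => if φ i = a then (1 : ℝ) else 0)ᴴ := by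
      ext i j
      simp [partitionMatrix, mul_apply, eq_comm]
    rw [this]
    exact posSemidef_self_mul_conjTranspose _
  · simp only [partitionMatrix, of_apply]
    split_ifs <;> norm_num

-- Writing `Y = Bᴴ * B` turns the trace into that of `(B * Q) * M * (B * Q)ᴴ`.
open scoped MatrixOrder in
lemma trace_mul_conj_nonneg {N : Type*} [Fintype N] [DecidableEq N] {M Y Q : Matrix N N ℝ}
    (hM : M.PosSemidef) (hY : Y.PosSemidef) (hQ : Qᵀ = Q) : 0 ≤ (M * (Q * Y * Q)).trace := by
  obtain ⟨B, rfl⟩ := CStarAlgebra.nonneg_iff_eq_star_mul_self.mp hY.nonneg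
  have := (hM.mul_mul_conjTranspose_same (B * Q)).trace_nonneg
  rw [conjTranspose_mul, conjTranspose_eq_transpose_of_trivial Q, hQ, Matrix.mul_assoc,
    Matrix.trace_mul_comm] at this
  simpa only [star_eq_conjTranspose, Matrix.mul_assoc] using this

lemma trace_mul_le_of_abs_le {N : Type*} [Fintype N] {M D : Matrix N N ℝ} {δ : ℝ}
    (hM : ∀ i j, |M i j| ≤ δ) : |(M * D).trace| ≤ δ * ∑ i, ∑ j, |D i j| := by
  rw [trace, Finset.sum_comm, Finset.mul_sum]
  have : ∀ i, |(M * D).diag i| ≤ ∑ j, δ * |D j i| := fun i => by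
    rw [diag_apply, mul_apply]
    refine (Finset.abs_sum_le_sum_abs _ _).trans (Finset.sum_le_sum fun j _ => ?_)
    rw [abs_mul]
    exact mul_le_mul_of_nonneg_right (hM i j) (abs_nonneg _)
  refine (Finset.abs_sum_le_sum_abs _ _).trans (Finset.sum_le_sum fun i _ => ?_)
  rw [Finset.mul_sum]
  exact this i

/-- The orthogonal projection onto the vectors that are constant on the clusters of `φ`. -/
noncomputable def clusterProj {n r : ℕ} (φ : Fin n → Fin r) : Matrix (Fin n) (Fin n) ℝ :=
  of fun i j => if φ i = φ j then (clusterSize φ (φ i) : ℝ)⁻¹ else 0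

variable {n r : ℕ} {φ : Fin n → Fin r}

lemma clusterSize_pos (φ : Fin n → Fin r) (i : Fin n) : 0 < clusterSize φ (φ i) :=
  Finset.card_pos.2 ⟨i, by simp⟩

lemma clusterProj_transpose : (clusterProj φ)ᵀ = clusterProj φ := by
  ext i j
  simp only [clusterProj, transpose_apply, of_apply]
  by_cases h : φ i = φ j
  · simp [h]
  · simp [h, Ne.symm h]

lemma clusterProj_mul_apply (M : Matrix (Fin n) (Fin n) ℝ) (i j : Fin n) :
    (clusterProj φ * M) i j =
      (clusterSize φ (φ i) : ℝ)⁻¹ * ∑ l ∈ Finset.univ.filter (fun l => φ l = φ i), M l j := by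
  rw [mul_apply, Finset.mul_sum, Finset.sum_filter]
  refine Finset.sum_congr rfl fun l _ => ?_
  by_cases h : φ l = φ i
  · simp [clusterProj, h]
  · simp [clusterProj, h, Ne.symm h]

lemma clusterProj_mul_of_const {M : Matrix (Fin n) (Fin n) ℝ}
    (hM : ∀ i l j, φ l = φ i → M l j = M i j) : clusterProj φ * M = M := by
  ext i j
  have hc : (0 : ℝ) < clusterSize φ (φ i) := by exact_mod_cast clusterSize_pos φ i
  rw [clusterProj_mul_apply, Finset.sum_congr rfl fun l hl => hM i l j (Finset.mem_filter.1 hl).2,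
    Finset.sum_const, nsmul_eq_mul]
  change _ * ((clusterSize φ (φ i) : ℝ) * _) = _
  field_simp

lemma clusterProj_mul_self : clusterProj φ * clusterProj φ = clusterProj φ :=
  clusterProj_mul_of_const fun i l j h => by simp only [clusterProj, of_apply, h]

lemma clusterProj_mul_partitionMatrix : clusterProj φ * partitionMatrix φ = partitionMatrix φ :=
  clusterProj_mul_of_const fun i l j h => by simp only [partitionMatrix, of_apply, h]

lemma sum_clusterProj (j : Fin n) : ∑ l, |clusterProj φ l j| = 1 := by
  have h : clusterProj φ * (of fun _ _ => 1 : Matrix (Fin n) (Fin n) ℝ) = of fun _ _ => 1 :=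
    clusterProj_mul_of_const fun i l j _ => rfl
  have h2 := congrFun (congrFun h j) j
  rw [mul_apply] at h2
  rw [← show _ = (1 : ℝ) from h2]
  refine Finset.sum_congr rfl fun l _ => ?_
  rw [of_apply, mul_one, ← clusterProj_transpose, transpose_apply, clusterProj_transpose]
  refine abs_of_nonneg ?_
  simp only [clusterProj, of_apply]
  split_ifs <;> positivity

/-- A deterministic sufficient condition for exact recovery: the noise `W` has small largest
eigenvalue and small averages over the clusters. -/
theorem isUniqueSDPSolution_of_noise_le {A W : Matrix (Fin n) (Fin n) ℝ} {p q K δ s : ℝ}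
    (hW : Wᵀ = W) (hA : ∀ i j, i ≠ j → A i j = pqMatrix r p q (φ i) (φ j) + W i j)
    (hK : 0 ≤ K) (hKW : (K • 1 - W).PosSemidef)
    (hrow : ∀ a j, |∑ i ∈ Finset.univ.filter (fun i => φ i = a), W i j| ≤ δ * clusterSize φ a)
    (hs : 0 < s) (hsize : ∀ a, s ≤ clusterSize φ a) (hpq : K / s + 3 * δ < (p - q) / 2) :
    IsUniqueSDPSolution A ((p + q) / 2) (partitionMatrix φ) := by
  set X := partitionMatrix φ with hX
  set P := clusterProj φ with hP
  have hPt : Pᵀ = P := clusterProj_transpose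
  have hPW : ∀ i j, |(P * W) i j| ≤ δ := by
    intro i j
    have hc : (0 : ℝ) < clusterSize φ (φ i) := by exact_mod_cast clusterSize_pos φ i
    rw [clusterProj_mul_apply, abs_mul, abs_of_pos (inv_pos.2 hc), inv_mul_le_iff₀ hc, mul_comm]
    exact hrow _ _
  have hWP : ∀ i j, |(W * P) i j| ≤ δ := by
    intro i j
    have : (W * P) i j = (P * W) j i := by
      rw [← transpose_apply (P * W), transpose_mul, hPt, hW]
    rw [this]; exact hPW j i
  -- The absolute column sums of `P` equal one, so a further multiplication by `P` does not increase
  -- the entrywise bound.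
  have hPWP : ∀ i j, |(P * W * P) i j| ≤ δ := by
    intro i j
    rw [mul_apply]
    refine (Finset.abs_sum_le_sum_abs _ _).trans ?_
    calc _ ≤ ∑ l, δ * |P l j| := Finset.sum_le_sum fun l _ => by
          rw [abs_mul]; exact mul_le_mul_of_nonneg_right (hPW i l) (abs_nonneg _)
      _ = δ := by rw [← Finset.mul_sum, sum_clusterProj, mul_one]
  have hPs : ∀ i j, |P i j| ≤ 1 / s := by
    intro i j
    simp only [hP, clusterProj, of_apply]
    split_ifs
    · rw [abs_of_nonneg (by positivity), one_div]
      exact inv_anti₀ hs (hsize _)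
    · rw [abs_zero]; positivity
  have noise : ∀ Y ∈ sdpFeasible n,
      (W * (Y - X)).trace ≤ (K / s + 3 * δ) * ∑ i, ∑ j, |(Y - X) i j| := by
    intro Y hY
    set D := Y - X with hD
    set Q := 1 - P with hQ
    have hQt : Qᵀ = Q := by rw [hQ, transpose_sub, transpose_one, hPt]
    have hQQ : Q * Q = Q := by
      have h : Q * Q = 1 - P - P + P * P := by rw [hQ]; noncomm_ring
      rw [h, hP, clusterProj_mul_self, sub_add_cancel]
    have hQX : Q * X = 0 := by
      rw [hQ, Matrix.sub_mul, Matrix.one_mul, hP, hX, clusterProj_mul_partitionMatrix, sub_self]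
    have hQD : Q * Y = Q * D := by rw [hD, Matrix.mul_sub, hQX, sub_zero]
    -- This is `D = Q D Q + P D + D P - P D P`, where `Q D Q = Q Y Q` because `Q X = 0`. Using `Y`
    -- in the first term makes that term positive semidefinite.
    have e1 : (W * D).trace = (W * (Q * Y * Q)).trace + (W * P * D).trace + (P * W * D).trace -
        (P * W * P * D).trace := by
      have h1 : (P * W * D).trace = (W * D * P).trace := by
        rw [Matrix.mul_assoc, Matrix.trace_mul_comm]
      have h2 : (P * W * P * D).trace = (W * P * D * P).trace := by
        rw [Matrix.mul_assoc, Matrix.mul_assoc, Matrix.trace_mul_comm]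
        simp only [Matrix.mul_assoc]
      rw [h1, h2, hQD, ← trace_add, ← trace_add, ← trace_sub, hQ]
      congr 1
      noncomm_ring
    have e2 : (W * (Q * Y * Q)).trace ≤ K * (Q * Y * Q).trace := by
      have := trace_mul_conj_nonneg hKW hY.1 hQt
      rw [Matrix.sub_mul, trace_sub, Matrix.smul_mul, Matrix.one_mul, trace_smul,
        smul_eq_mul] at this
      linarith
    have hDtr : D.trace = 0 := Finset.sum_eq_zero fun i _ => by
      simp [hD, hX, hY.2.2 i, partitionMatrix]
    -- `D` has zero diagonal, so its trace vanishes and only the part seen by `P` remains, whose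
    -- entries are at most `1 / s`.
    have e3 : (Q * Y * Q).trace = - (P * D).trace := by
      rw [Matrix.trace_mul_comm, ← Matrix.mul_assoc, hQQ, hQD, hQ, Matrix.sub_mul, trace_sub,
        Matrix.one_mul, hDtr, zero_sub]
    have b0 := (abs_le.1 (trace_mul_le_of_abs_le (D := D) hPs)).1
    have b1 := (abs_le.1 (trace_mul_le_of_abs_le (D := D) hWP)).2
    have b2 := (abs_le.1 (trace_mul_le_of_abs_le (D := D) hPW)).2
    have b3 := (abs_le.1 (trace_mul_le_of_abs_le (D := D) hPWP)).1
    have e4 : K * (Q * Y * Q).trace ≤ K * (1 / s * ∑ i, ∑ j, |D i j|) :=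
      mul_le_mul_of_nonneg_left (by rw [e3]; linarith) hK
    have e5 : K * (1 / s * ∑ i, ∑ j, |D i j|) = K / s * ∑ i, ∑ j, |D i j| := by ring
    linarith
  -- Within clusters `D ≤ 0` and the mean of `A - λ J` is `(p - q) / 2`; across clusters `D ≥ 0` and
  -- the mean is `-(p - q) / 2`. Both cases contribute `-(p - q) / 2 * |D i j|`, and the diagonal
  -- contributes nothing.
  have gap : ∀ Y ∈ sdpFeasible n, sdpObjective A ((p + q) / 2) Y -
      sdpObjective A ((p + q) / 2) X =
        (W * (Y - X)).trace - (p - q) / 2 * ∑ i, ∑ j, |(Y - X) i j| := by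
    intro Y hY
    have htr : (W * (Y - X)).trace = ∑ i, ∑ j, W i j * (Y - X) i j := by
      rw [trace, Finset.sum_comm]
      refine Finset.sum_congr rfl fun i _ => ?_
      rw [diag_apply, mul_apply]
      refine Finset.sum_congr rfl fun j _ => ?_
      rw [← transpose_apply W j i, hW]
    rw [sdpObjective_eq_sum, sdpObjective_eq_sum, htr, Finset.mul_sum, ← Finset.sum_sub_distrib,
      ← Finset.sum_sub_distrib]
    refine Finset.sum_congr rfl fun i _ => ?_
    rw [Finset.mul_sum, ← Finset.sum_sub_distrib, ← Finset.sum_sub_distrib]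
    refine Finset.sum_congr rfl fun j _ => ?_
    rw [Matrix.sub_apply]
    rcases eq_or_ne i j with rfl | hij
    · simp [hX, partitionMatrix, hY.2.2]
    · rw [hA i j hij]
      by_cases h : φ i = φ j
      · have hx : X i j = 1 := by simp [hX, partitionMatrix, h]
        have := le_one_of_mem_sdpFeasible hY i j
        rw [hx, abs_of_nonpos (by linarith)]
        simp only [pqMatrix, of_apply, h, if_true]; ring
      · have hx : X i j = 0 := by simp [hX, partitionMatrix, h]
        rw [hx, sub_zero, abs_of_nonneg (hY.2.1 i j)]
        simp only [pqMatrix, of_apply, h, if_false]; ring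
  have hN : ∀ Y : Matrix (Fin n) (Fin n) ℝ, 0 ≤ ∑ i, ∑ j, |(Y - X) i j| := fun Y =>
    Finset.sum_nonneg fun i _ => Finset.sum_nonneg fun j _ => abs_nonneg _
  have hXf : X ∈ sdpFeasible n := partitionMatrix_mem_sdpFeasible φ
  refine ⟨⟨hXf, fun Y hY => ?_⟩, fun Y hY => ?_⟩
  · have h1 := noise Y hY
    have h2 := gap Y hY
    have h3 := mul_nonneg (sub_nonneg.2 hpq.le) (hN Y)
    linarith
  · have h1 := noise Y hY.1
    have h2 := gap Y hY.1
    have h4 := hY.2 X hXf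
    have h5 : ∑ i, ∑ j, |(Y - X) i j| = 0 := by
      refine le_antisymm (not_lt.1 fun h => ?_) (hN Y)
      have h3 := mul_pos (sub_pos.2 hpq) h
      linarith
    ext i j
    have h6 := (Finset.sum_eq_zero_iff_of_nonneg
      fun i _ => Finset.sum_nonneg fun j _ => abs_nonneg ((Y - X) i j)).1 h5 i (Finset.mem_univ i)
    have h7 := (Finset.sum_eq_zero_iff_of_nonneg
      fun j _ => abs_nonneg ((Y - X) i j)).1 h6 j (Finset.mem_univ j)
    exact sub_eq_zero.1 (abs_eq_zero.1 h7)

end Certificate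

/-! ### The noise matrix as a sum over edges, and its tail bounds -/

section Edges

open Matrix MeasureTheory ProbabilityTheory

/-- The potential edges of a simple graph on `Fin n`. -/
abbrev Edge (n : ℕ) : Type := {e : Fin n × Fin n // e.1 < e.2}

/-- The adjacency matrix of the graph with the single edge `e`. -/
def edgeMatrix {n : ℕ} (e : Edge n) : Matrix (Fin n) (Fin n) ℝ :=
  of fun i j => if (i = e.1.1 ∧ j = e.1.2) ∨ (i = e.1.2 ∧ j = e.1.1) then 1 else 0

variable {n : ℕ}

lemma edgeMatrix_transpose (e : Edge n) : (edgeMatrix e)ᵀ = edgeMatrix e := by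
  ext i j
  simp only [edgeMatrix, transpose_apply, of_apply]
  congr 1
  exact propext (by tauto)

lemma edgeMatrix_nonneg (e : Edge n) (i j : Fin n) : 0 ≤ edgeMatrix e i j := by
  simp only [edgeMatrix, of_apply]
  split_ifs <;> norm_num

lemma sum_edgeMatrix_le_one (e : Edge n) (T : Finset (Fin n)) (j : Fin n) :
    ∑ i ∈ T, edgeMatrix e i j ≤ 1 := by
  obtain ⟨⟨u, v⟩, huv⟩ := e
  have h : ∀ w, (∀ i, edgeMatrix ⟨(u, v), huv⟩ i j ≤ if i = w then (1 : ℝ) else 0) →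
      ∑ i ∈ T, edgeMatrix ⟨(u, v), huv⟩ i j ≤ 1 := by
    intro w hw
    refine (Finset.sum_le_sum fun i _ => hw i).trans ?_
    rw [Finset.sum_ite_eq']
    split_ifs <;> norm_num
  by_cases hj : j = u
  · refine h v fun i => ?_
    have : u ≠ v := ne_of_lt huv
    simp only [edgeMatrix, of_apply, hj]
    split_ifs <;> simp_all
  · refine h u fun i => ?_
    simp only [edgeMatrix, of_apply]
    split_ifs <;> simp_all

/-- An edge matrix exchanges its two endpoints and kills the other basis vectors, so its square
projects onto the endpoints. Writing the diagonal as column sums lets the same estimates serve for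
degrees and for partial column sums. -/
lemma edgeMatrix_mul_self (e : Edge n) :
    edgeMatrix e * edgeMatrix e = diagonal fun i => ∑ j, edgeMatrix e j i := by
  obtain ⟨⟨u, v⟩, huv⟩ := e
  have hne : u ≠ v := ne_of_lt huv
  ext i l
  rw [mul_apply, diagonal_apply]
  split_ifs with h
  · subst h
    refine Finset.sum_congr rfl fun j _ => ?_
    rw [← transpose_apply (edgeMatrix _) j i, edgeMatrix_transpose]
    simp only [edgeMatrix, of_apply]
    split_ifs <;> norm_num
  · refine Finset.sum_eq_zero fun j _ => ?_
    simp only [edgeMatrix, of_apply]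
    split_ifs with h1 h2 <;> simp_all
    rcases h1 with h1 | h1 <;> rcases h2 with h2 | h2 <;> simp_all

lemma sum_smul_edgeMatrix_of_lt (c : Edge n → ℝ) {i j : Fin n} (h : i < j) :
    (∑ e, c e • edgeMatrix e) i j = c ⟨(i, j), h⟩ := by
  rw [Matrix.sum_apply, Finset.sum_eq_single ⟨(i, j), h⟩]
  · simp [edgeMatrix]
  · rintro ⟨⟨u, v⟩, huv⟩ - hne
    have : ¬ ((i = u ∧ j = v) ∨ (i = v ∧ j = u)) := by
      rintro (⟨rfl, rfl⟩ | ⟨rfl, rfl⟩)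
      · exact hne rfl
      · exact lt_asymm h huv
    simp [edgeMatrix, this]
  · simp

lemma sum_smul_edgeMatrix_transpose (c : Edge n → ℝ) :
    (∑ e, c e • edgeMatrix e)ᵀ = ∑ e, c e • edgeMatrix e := by
  simp only [transpose_sum, transpose_smul, edgeMatrix_transpose]

lemma sum_edgeMatrix_apply_le_one (i j : Fin n) : ∑ e, edgeMatrix e i j ≤ 1 := by
  have h1 : ∑ e, edgeMatrix e i j = (∑ e, (1 : ℝ) • edgeMatrix e) i j := by
    rw [Matrix.sum_apply]; simp
  rw [h1]
  rcases lt_trichotomy i j with h | h | h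
  · rw [sum_smul_edgeMatrix_of_lt (fun _ => 1) h]
  · subst h
    rw [Matrix.sum_apply]
    refine (Finset.sum_nonpos fun e _ => ?_).trans zero_le_one
    obtain ⟨⟨u, v⟩, huv⟩ := e
    have : ¬ ((i = u ∧ i = v) ∨ (i = v ∧ i = u)) := by
      rintro (⟨rfl, rfl⟩ | ⟨rfl, rfl⟩) <;> exact lt_irrefl _ huv
    simp [edgeMatrix, this]
  · rw [← sum_smul_edgeMatrix_transpose, transpose_apply,
      sum_smul_edgeMatrix_of_lt (fun _ => 1) h]

lemma sum_sum_edgeMatrix_le (T : Finset (Fin n)) (j : Fin n) :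
    ∑ e, ∑ i ∈ T, edgeMatrix e i j ≤ n := by
  rw [Finset.sum_comm]
  calc _ ≤ ∑ i ∈ T, (1 : ℝ) := Finset.sum_le_sum fun i _ => sum_edgeMatrix_apply_le_one i j
    _ = T.card := by simp
    _ ≤ n := by exact_mod_cast (Finset.card_le_univ T).trans (by simp)

lemma sum_sum_smul_edgeMatrix (c : Edge n → ℝ) (T : Finset (Fin n)) (j : Fin n) :
    ∑ i ∈ T, (∑ e, c e • edgeMatrix e) i j = ∑ e, (∑ i ∈ T, edgeMatrix e i j) * c e := by
  simp only [Matrix.sum_apply, Matrix.smul_apply, smul_eq_mul, Finset.sum_mul]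
  rw [Finset.sum_comm]
  exact Finset.sum_congr rfl fun e _ => Finset.sum_congr rfl fun i _ => mul_comm _ _

/-- The centred random adjacency matrix as a function of the edge indicators. -/
noncomputable def noise (p : Edge n → ℝ) (x : Edge n → Bool) : Matrix (Fin n) (Fin n) ℝ :=
  ∑ e, centred p x e • edgeMatrix e

lemma noise_transpose (p : Edge n → ℝ) (x : Edge n → Bool) : (noise p x)ᵀ = noise p x :=
  sum_smul_edgeMatrix_transpose _

variable {p : Edge n → ℝ} {P : ℝ}

/-- A tail bound for the largest eigenvalue of the noise, through a high moment. -/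
lemma bernExp_trace_noise_gt_le (h0 : ∀ e, 0 ≤ p e) (h1 : ∀ e, p e ≤ 1) (hP : ∀ e, p e ≤ P)
    (hP0 : 0 ≤ P) {k : ℕ} (hk : ((k : ℝ) + 1) ≤ n * P) {K : ℝ}
    (hK : K ^ 2 = 2 * (k + 1) * (n * P * Real.exp 4) * Real.exp 12) :
    bernExp p ({x | K ^ (2 * (k + 1)) < (noise p x ^ (2 * (k + 1))).trace}.indicator
      fun _ => (1 : ℝ)) ≤ n * Real.exp (-12 * (k + 1)) := by
  have hnP : 0 < n * P := lt_of_lt_of_le (by positivity) hk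
  have ht : 0 < K ^ (2 * (k + 1)) := by rw [pow_mul, hK]; positivity
  refine (bernExp_indicator_le h0 h1 (f := fun x => (noise p x ^ (2 * (k + 1))).trace)
    (fun x => trace_pow_two_mul_nonneg (noise_transpose p x) _) ht fun x hx => le_of_lt hx).trans ?_
  rw [div_le_iff₀ ht]
  refine (bernExp_trace_pow_le h0 h1 edgeMatrix_transpose
    (fun e i => Finset.sum_nonneg fun j _ => edgeMatrix_nonneg e j i)
    edgeMatrix_mul_self k).trans ?_
  -- The weights at `i` mark the edges incident to `i`; their total is at most `n`, so the moment
  -- bound applies with `D = n`.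
  have hi : ∀ i : Fin n, bernExp p (fun x => (2 * ((k : ℝ) + 1) *
      ∑ e, (∑ j, edgeMatrix e j i) * absCentred p x e) ^ (k + 1)) ≤
      (2 * (k + 1)) ^ (k + 1) * (n * P * Real.exp 4) ^ (k + 1) := by
    intro i
    simp only [mul_pow (2 * ((k : ℝ) + 1))]
    rw [bernExp_const_mul]
    exact mul_le_mul_of_nonneg_left (bernExp_sum_absCentred_pow_le h0 h1
      (fun e => Finset.sum_nonneg fun j _ => edgeMatrix_nonneg e j i)
      (fun e => sum_edgeMatrix_le_one e _ i) hP hP0 (sum_sum_edgeMatrix_le _ i)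
      (by push_cast; exact hk) hnP) (by positivity)
  refine (Finset.sum_le_sum fun i _ => hi i).trans (le_of_eq ?_)
  rw [Finset.sum_const, Finset.card_univ, Fintype.card_fin, nsmul_eq_mul, pow_mul, hK,
    mul_pow _ (Real.exp 12), mul_pow _ (n * P * Real.exp 4), ← Real.exp_nat_mul _ (k + 1)]
  -- The extra factor `exp 12` in `K ^ 2`, raised to the power `k + 1`, is exactly what Markov's
  -- inequality turns into the tail.
  have : Real.exp (-12 * (k + 1)) * Real.exp (((k + 1 : ℕ) : ℝ) * 12) = 1 := by
    rw [← Real.exp_add, Real.exp_eq_one_iff]; push_cast; ring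
  linear_combination
    (-(n * ((2 * ((k : ℝ) + 1)) ^ (k + 1) * (n * P * Real.exp 4) ^ (k + 1)))) * this

/-- A tail bound for partial column sums of the noise. -/
lemma bernExp_sum_noise_gt_le (h0 : ∀ e, 0 ≤ p e) (h1 : ∀ e, p e ≤ 1) (hP : ∀ e, p e ≤ P)
    (hP0 : 0 ≤ P) (T : Finset (Fin n)) (j : Fin n) {σ θ t : ℝ} (hσ : |σ| = 1) (hθ0 : 0 ≤ θ)
    (hθ1 : θ ≤ 1) :
    bernExp p ({x | t < σ * ∑ i ∈ T, noise p x i j}.indicator fun _ => (1 : ℝ)) ≤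
      Real.exp (θ ^ 2 * P * n - θ * t) := by
  refine (bernExp_indicator_le h0 h1
    (f := fun x => Real.exp ((θ * σ) * ∑ e, (∑ i ∈ T, edgeMatrix e i j) * centred p x e))
    (fun x => (Real.exp_pos _).le) (Real.exp_pos (θ * t)) fun x hx => ?_).trans ?_
  · rw [← sum_sum_smul_edgeMatrix, mul_assoc, Real.exp_le_exp]
    exact mul_le_mul_of_nonneg_left (le_of_lt hx) hθ0
  · rw [Real.exp_sub]
    refine div_le_div_of_nonneg_right ?_ (Real.exp_pos _).le
    refine (bernExp_exp_centred_le h0 h1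
      (fun e => Finset.sum_nonneg fun i _ => edgeMatrix_nonneg e i j)
      (fun e => sum_edgeMatrix_le_one e T j)
      (by rw [abs_mul, hσ, mul_one, abs_of_nonneg hθ0]; exact hθ1) hP).trans ?_
    rw [Real.exp_le_exp, mul_pow, ← sq_abs σ, hσ, one_pow, mul_one]
    exact mul_le_mul_of_nonneg_left (sum_sum_edgeMatrix_le T j) (by positivity)

open Classical in
/-- The edge indicators of a graph. -/
noncomputable def edgeIndicator (G : SimpleGraph (Fin n)) (e : Edge n) : Bool :=
  decide (G.Adj e.1.1 e.1.2)

/-- The edge probabilities of the stochastic block model. -/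
def edgeProb {r : ℕ} (φ : Fin n → Fin r) (B : Matrix (Fin r) (Fin r) ℝ) (e : Edge n) : ℝ :=
  B (φ e.1.1) (φ e.1.2)

/-- The identity is confined to `i ≠ j`: on the diagonal the adjacency matrix and the noise vanish
while `B (φ i) (φ i)` need not. This is harmless because feasible matrices share the same diagonal.
-/
lemma adjacencyMatrix_eq_add_noise {r : ℕ} (φ : Fin n → Fin r) {B : Matrix (Fin r) (Fin r) ℝ}
    (hB : Bᵀ = B) (G : SimpleGraph (Fin n)) {i j : Fin n} (hij : i ≠ j) :
    adjacencyMatrix G i j = B (φ i) (φ j) + noise (edgeProb φ B) (edgeIndicator G) i j := by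
  have hlt : ∀ {i j : Fin n}, i < j →
      adjacencyMatrix G i j = B (φ i) (φ j) + noise (edgeProb φ B) (edgeIndicator G) i j := by
    intro i j h
    rw [noise, sum_smul_edgeMatrix_of_lt _ h]
    by_cases hG : G.Adj i j <;>
      simp [adjacencyMatrix, SimpleGraph.adjMatrix_apply, centred, edgeIndicator, edgeProb, hG]
  rcases lt_or_gt_of_ne hij with h | h
  · exact hlt h
  · have h2 := hlt h
    have h3 : adjacencyMatrix G i j = adjacencyMatrix G j i := by
      by_cases hG : G.Adj i j
      · simp [adjacencyMatrix, SimpleGraph.adjMatrix_apply, hG, hG.symm]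
      · simp [adjacencyMatrix, SimpleGraph.adjMatrix_apply, hG, mt SimpleGraph.Adj.symm hG]
    rw [h3, h2, ← transpose_apply (noise _ _), noise_transpose, ← transpose_apply B, hB]

variable {Ω : Type*} [MeasurableSpace Ω] {μ : Measure Ω} {r : ℕ} {φ : Fin n → Fin r}
  {B : Matrix (Fin r) (Fin r) ℝ} {G : Ω → SimpleGraph (Fin n)}

/-- The law of the edge indicators in the stochastic block model. -/
lemma IsSBM.measureReal_edgeIndicator_eq [IsProbabilityMeasure μ] (h : IsSBM μ φ B G)
    (x : Edge n → Bool) :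
    μ.real {ω | edgeIndicator (G ω) = x} = bernWeight (edgeProb φ B) x := by
  set s : Edge n → Set Ω := fun e => {ω | (G ω).Adj e.1.1 e.1.2} with hs
  have hset : {ω | edgeIndicator (G ω) = x} = ⋂ e, cond (x e) (s e) (s e)ᶜ := by
    ext ω
    simp only [Set.mem_ofPred_eq, Set.mem_iInter, funext_iff]
    refine forall_congr' fun e => ?_
    cases hx : x e <;> simp [edgeIndicator, hs]
  have hind := (iIndepSet_iff_iIndep s μ).1 h.indep_adj
  have hm : ∀ e, MeasurableSet[MeasurableSpace.generateFrom {s e}] (s e) := fun e =>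
    MeasurableSpace.measurableSet_generateFrom rfl
  rw [hset, measureReal_def, hind.meas_iInter (s := fun e => cond (x e) (s e) (s e)ᶜ) fun e => by
    cases x e
    · exact (hm e).compl
    · exact hm e, ENNReal.toReal_prod, bernWeight]
  refine Finset.prod_congr rfl fun e _ => ?_
  have hp : μ.real (s e) = edgeProb φ B e := h.prob_adj _ _ e.2
  cases x e
  · have := measureReal_compl (μ := μ) (h.measurableSet_adj _ _ e.2)
    rw [probReal_univ] at this
    rw [cond_false, cond_false, ← hp]
    exact this
  · exact hp

lemma IsSBM.one_sub_le_measureReal [IsProbabilityMeasure μ] (h : IsSBM μ φ B G)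
    {bad : Set (Edge n → Bool)} {E : Set Ω} (hE : ∀ ω, edgeIndicator (G ω) ∉ bad → ω ∈ E) :
    1 - bernExp (edgeProb φ B) (bad.indicator fun _ => 1) ≤ μ.real E := by
  classical
  have h1 : μ.real Eᶜ ≤ bernExp (edgeProb φ B) (bad.indicator fun _ => 1) := by
    have hsub : Eᶜ ⊆ ⋃ x ∈ Finset.univ.filter (· ∈ bad), {ω | edgeIndicator (G ω) = x} := by
      intro ω hω
      simp only [Finset.mem_filter, Finset.mem_univ, true_and, Set.mem_iUnion, Set.mem_ofPred_eq,
        exists_prop, exists_eq_right']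
      exact not_not.1 fun hb => hω (hE ω hb)
    refine (measureReal_mono hsub (measure_ne_top μ _)).trans ((measureReal_biUnion_finset_le _ _).trans ?_)
    rw [bernExp, Finset.sum_filter]
    refine Finset.sum_le_sum fun x _ => ?_
    rw [h.measureReal_edgeIndicator_eq]
    by_cases hx : x ∈ bad <;> simp [hx]
  -- The event `E` is not assumed measurable, so subadditivity replaces the formula for the measure
  -- of a complement.
  have h2 := measureReal_union_le (μ := μ) E Eᶜ
  rw [Set.union_compl_self, probReal_univ] at h2
  linarith

end Edges

/-! ### Choice of parameters and union bound -/

open Matrix MeasureTheory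

lemma pqMatrix_transpose (r : ℕ) (p q : ℝ) : (pqMatrix r p q)ᵀ = pqMatrix r p q := by
  ext a b
  simp only [pqMatrix, transpose_apply, of_apply, eq_comm]

/-- Exact recovery in the stochastic block model under quantitative assumptions on the parameters:
the number `L` plays the role of `log n`. -/
theorem IsSBM.one_sub_le_measureReal_isUnique {n r : ℕ} {φ : Fin n → Fin r} {p q c L : ℝ}
    {Ω : Type*} [MeasurableSpace Ω] {μ : Measure Ω} [IsProbabilityMeasure μ]
    {G : Ω → SimpleGraph (Fin n)} (hG : IsSBM μ φ (pqMatrix r p q) G) (hc : 0 < c) (hc1 : c ≤ 1)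
    (hn : 0 < n) (hsize : ∀ a, c * (n : ℝ) ≤ clusterSize φ a) (hq : 0 ≤ q) (hp1 : p ≤ 1)
    (hpq : q < p) (hL : 1 / 2 ≤ L)
    (hgap : (16 * Real.exp 8 / c) ^ 2 * (p * L) ≤ n * (p - q) ^ 2) :
    1 - (1 + 2 * r) * (n * Real.exp (-12 * L)) ≤
      μ.real {ω | IsUniqueSDPSolution (adjacencyMatrix (G ω)) ((p + q) / 2)
        (partitionMatrix φ)} := by
  have hp : 0 < p := lt_of_le_of_lt hq hpq
  have hn' : (0 : ℝ) < n := by exact_mod_cast hn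
  have he8 : (9 : ℝ) ≤ Real.exp 8 := by linarith [Real.add_one_le_exp (8 : ℝ)]
  have he16 : Real.exp 16 = Real.exp 8 ^ 2 := by rw [← Real.exp_nat_mul]; norm_num
  have hgap' : 256 * Real.exp 16 * (p * L) ≤ c ^ 2 * (n * (p - q) ^ 2) := by
    have := mul_le_mul_of_nonneg_left hgap (sq_nonneg c)
    rw [he16]
    calc _ = c ^ 2 * ((16 * Real.exp 8 / c) ^ 2 * (p * L)) := by field_simp; norm_num
      _ ≤ _ := this
  have he16' : (81 : ℝ) ≤ Real.exp 16 := by rw [he16]; nlinarith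
  have hpL : 0 < p * L := by positivity
  -- Here `k + 1 = ⌈L⌉`, and `⌈L⌉ < L + 1 ≤ 3 * L` since `L ≥ 1 / 2`.
  obtain ⟨k, hk1, hk2⟩ : ∃ k : ℕ, L ≤ k + 1 ∧ (k : ℝ) + 1 ≤ 3 * L := by
    refine ⟨⌈L⌉₊ - 1, ?_⟩
    have h1 : 1 ≤ ⌈L⌉₊ := Nat.one_le_ceil_iff.2 (by linarith)
    rw [Nat.cast_sub h1]
    have h2 := Nat.le_ceil L
    have h3 := Nat.ceil_lt_add_one (show 0 ≤ L by linarith)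
    push_cast
    constructor <;> linarith
  set P : Edge n → ℝ := edgeProb φ (pqMatrix r p q) with hP
  have hPq : ∀ e, P e = p ∨ P e = q := fun e => by
    simp only [hP, edgeProb, pqMatrix, of_apply]
    split_ifs <;> simp
  have h0 : ∀ e, 0 ≤ P e := fun e => by rcases hPq e with h | h <;> rw [h] <;> linarith
  have hPp : ∀ e, P e ≤ p := fun e => by rcases hPq e with h | h <;> rw [h]; linarith
  have h1 : ∀ e, P e ≤ 1 := fun e => (hPp e).trans hp1
  set K : ℝ := Real.sqrt (2 * (k + 1) * (n * p * Real.exp 4) * Real.exp 12) with hKdef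
  have hK : K ^ 2 = 2 * (k + 1) * (n * p * Real.exp 4) * Real.exp 12 :=
    Real.sq_sqrt (by positivity)
  -- Since `p - q ≤ p` and `c ≤ 1`, the gap assumption forces `n * p ≥ 3 * L`, which is the density
  -- required by the moment bound.
  have hnp : ((k : ℝ) + 1) ≤ n * p := by
    have a1 : c ^ 2 ≤ 1 := pow_le_one₀ hc.le hc1
    have a2 : (p - q) ^ 2 ≤ p ^ 2 := pow_le_pow_left₀ (by linarith) (by linarith) 2
    have a3 : c ^ 2 * (n * (p - q) ^ 2) ≤ 1 * (n * p ^ 2) := by gcongr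
    have a4 : 3 * (p * L) ≤ 256 * Real.exp 16 * (p * L) := by gcongr; linarith
    have a5 : p * (3 * L) ≤ p * (n * p) := by linarith
    exact hk2.trans (le_of_mul_le_mul_left a5 hp)
  have hKle : K ≤ c * n * ((p - q) / 4) := by
    refine Real.sqrt_le_iff.2 ⟨by have := sub_pos.2 hpq; positivity, ?_⟩
    have b1 : Real.exp 4 * Real.exp 12 = Real.exp 16 := by rw [← Real.exp_add]; norm_num
    calc _ = 2 * (k + 1) * (n * p) * (Real.exp 4 * Real.exp 12) := by ring
      _ ≤ 2 * (3 * L) * (n * p) * (Real.exp 4 * Real.exp 12) := by gcongr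
      _ = n * (6 * (Real.exp 16 * (p * L))) := by rw [b1]; ring
      _ ≤ n * (c ^ 2 * (n * (p - q) ^ 2) / 16) := by
        gcongr
        have := mul_pos (Real.exp_pos 16) hpL
        linarith
      _ = _ := by ring
  -- With `s = c * n`, the certificate needs `K / s + 3 * δ < (p - q) / 2`; the budget used is `1 /
  -- 4 + 3 / 16 = 7 / 16` of `p - q`.
  set δ : ℝ := (p - q) / 16 with hδ
  -- The minimiser of the Chernoff exponent `θ ^ 2 * p * n - θ * (δ * (c * n))`.
  set θ : ℝ := c * (p - q) / (32 * p) with hθ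
  have hθ0 : 0 ≤ θ := by have := sub_pos.2 hpq; positivity
  have hθ1 : θ ≤ 1 := by
    rw [hθ, div_le_one (by positivity)]
    have := mul_le_mul hc1 (show p - q ≤ p by linarith) (by linarith) zero_le_one
    linarith
  set bad0 : Set (Edge n → Bool) :=
    {x | K ^ (2 * (k + 1)) < (noise P x ^ (2 * (k + 1))).trace} with hbad0
  set cl : Fin r → Finset (Fin n) := fun a => Finset.univ.filter fun i => φ i = a with hcl
  set bad1 : ℝ → Fin n → Fin r → Set (Edge n → Bool) := fun σ j a =>
    {x | δ * clusterSize φ a < σ * ∑ i ∈ cl a, noise P x i j} with hbad1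
  have hb0 : bernExp P (bad0.indicator fun _ => 1) ≤ n * Real.exp (-12 * L) := by
    refine (bernExp_trace_noise_gt_le h0 h1 hPp hp.le hnp hK).trans ?_
    gcongr ?_ * Real.exp ?_
    linarith
  have hb1 : ∀ σ : ℝ, |σ| = 1 → ∀ j a,
      bernExp P ((bad1 σ j a).indicator fun _ => 1) ≤ Real.exp (-12 * L) := by
    intro σ hσ j a
    refine (bernExp_sum_noise_gt_le h0 h1 hPp hp.le (cl a) j hσ hθ0 hθ1).trans ?_
    rw [Real.exp_le_exp]
    have c1 : θ * (δ * (c * n)) ≤ θ * (δ * clusterSize φ a) := by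
      have := sub_pos.2 hpq
      gcongr
      exact hsize a
    have c2 : θ ^ 2 * p * n - θ * (δ * (c * n)) = - (c ^ 2 * (n * (p - q) ^ 2) / (1024 * p)) := by
      rw [hθ, hδ]; field_simp; ring
    have c3 : 12 * L ≤ c ^ 2 * (n * (p - q) ^ 2) / (1024 * p) := by
      rw [le_div_iff₀ (by positivity)]
      have := mul_le_mul_of_nonneg_right he16' hpL.le
      linarith
    linarith
  -- One spectral event of probability at most `n * exp (-12 * L)`, and two signed events for each
  -- of the `n * r` pairs of a column and a cluster, each of probability at most `exp (-12 * L)`.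
  set bad : Set (Edge n → Bool) := bad0 ∪ ⋃ j, ⋃ a, (bad1 1 j a ∪ bad1 (-1) j a) with hbad
  have hbadle : bernExp P (bad.indicator fun _ => 1) ≤
      (1 + 2 * r) * (n * Real.exp (-12 * L)) := by
    have d1 : ∀ x, bad.indicator (fun _ => (1 : ℝ)) x ≤ bad0.indicator (fun _ => 1) x +
        ∑ j, ∑ a, ((bad1 1 j a).indicator (fun _ => 1) x +
          (bad1 (-1) j a).indicator (fun _ => 1) x) := by
      intro x
      have hi : ∀ (S : Set (Edge n → Bool)), 0 ≤ S.indicator (fun _ => (1 : ℝ)) x := fun S =>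
        Set.indicator_nonneg (fun _ _ => zero_le_one) x
      have hsum : ∀ j, 0 ≤ ∑ a, ((bad1 1 j a).indicator (fun _ => (1 : ℝ)) x +
          (bad1 (-1) j a).indicator (fun _ => 1) x) := fun j =>
        Finset.sum_nonneg fun a _ => add_nonneg (hi _) (hi _)
      by_cases hx : x ∈ bad
      · rw [Set.indicator_of_mem hx]
        rcases hx with hx | hx
        · rw [Set.indicator_of_mem hx]
          exact le_add_of_nonneg_right (Finset.sum_nonneg fun j _ => hsum j)
        · obtain ⟨j, hj⟩ := Set.mem_iUnion.1 hx
          obtain ⟨a, ha⟩ := Set.mem_iUnion.1 hj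
          refine le_add_of_nonneg_of_le (hi _) ?_
          refine le_trans ?_ (Finset.single_le_sum (fun j _ => hsum j) (Finset.mem_univ j))
          refine le_trans ?_ (Finset.single_le_sum (fun a _ => add_nonneg (hi _) (hi _))
            (Finset.mem_univ a))
          rcases ha with ha | ha
          · rw [Set.indicator_of_mem ha]; exact le_add_of_nonneg_right (hi _)
          · rw [Set.indicator_of_mem ha (fun _ => (1 : ℝ))]; exact le_add_of_nonneg_left (hi _)
      · rw [Set.indicator_of_notMem hx]
        exact add_nonneg (hi _) (Finset.sum_nonneg fun j _ => hsum j)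
    refine (bernExp_mono h0 h1 d1).trans ?_
    simp only [bernExp_add, bernExp_sum]
    have d2 : ∑ j : Fin n, ∑ a : Fin r, (bernExp P ((bad1 1 j a).indicator fun _ => 1) +
        bernExp P ((bad1 (-1) j a).indicator fun _ => 1)) ≤
        ∑ _j : Fin n, ∑ _a : Fin r, (Real.exp (-12 * L) + Real.exp (-12 * L)) :=
      Finset.sum_le_sum fun j _ => Finset.sum_le_sum fun a _ =>
        add_le_add (hb1 1 (by simp) j a) (hb1 (-1) (by simp) j a)
    simp only [Finset.sum_const, Finset.card_univ, Fintype.card_fin, nsmul_eq_mul] at d2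
    calc _ ≤ n * Real.exp (-12 * L) + n * (r * (Real.exp (-12 * L) + Real.exp (-12 * L))) :=
          add_le_add hb0 d2
      _ = _ := by ring
  refine le_trans (sub_le_sub_left hbadle 1) (hG.one_sub_le_measureReal fun ω hω => ?_)
  set x := edgeIndicator (G ω)
  have hω0 : x ∉ bad0 := fun h => hω (Or.inl h)
  have hω1 : ∀ j a, x ∉ bad1 1 j a ∧ x ∉ bad1 (-1) j a := fun j a =>
    ⟨fun h => hω (Or.inr (Set.mem_iUnion₂.2 ⟨j, a, Or.inl h⟩)),
      fun h => hω (Or.inr (Set.mem_iUnion₂.2 ⟨j, a, Or.inr h⟩))⟩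
  refine isUniqueSDPSolution_of_noise_le (W := noise P x) (δ := δ) (s := c * n)
    (noise_transpose P x)
    (fun i j hij => adjacencyMatrix_eq_add_noise φ (pqMatrix_transpose r p q) (G ω) hij)
    (Real.sqrt_nonneg _)
    (posSemidef_smul_one_sub (noise_transpose P x) (Real.sqrt_nonneg _) k.succ_ne_zero
      (not_lt.1 hω0)) (fun a j => ?_) (by positivity) hsize ?_
  · have e1 : 1 * ∑ i ∈ cl a, noise P x i j ≤ δ * clusterSize φ a := not_lt.1 (hω1 j a).1
    have e2 : -1 * ∑ i ∈ cl a, noise P x i j ≤ δ * clusterSize φ a := not_lt.1 (hω1 j a).2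
    exact abs_le.2 ⟨by linarith, by linarith⟩
  · have : K / (c * n) ≤ (p - q) / 4 := by
      rw [div_le_iff₀ (by positivity)]; linarith
    rw [hδ]
    linarith

end SBM

/-! ### Exact recovery for two clusters, including small `n` -/

theorem mainTheorem1 :
    ∀ c : ℝ, 0 < c → ∃ C₀ : ℝ, 0 < C₀ ∧
      ∀ (n : ℕ) (φ : Fin n → Fin 2) (p q : ℝ),
        (∀ a, c * (n : ℝ) ≤ (SBM.clusterSize φ a : ℝ)) →
        0 ≤ q → q ≤ 1 → 0 ≤ p → p ≤ 1 →
        C₀ * Real.sqrt (p * Real.log n / n) < p - q →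
        ∃ lam : ℝ,
          ∀ (Ω : Type*) [MeasurableSpace Ω] (μ : MeasureTheory.Measure Ω)
            [MeasureTheory.IsProbabilityMeasure μ] (G : Ω → SimpleGraph (Fin n)),
            SBM.IsSBM μ φ (SBM.pqMatrix 2 p q) G →
            1 - 10 * (n : ℝ) ^ (-10 : ℤ) ≤
              μ.real {ω | SBM.IsUniqueSDPSolution (SBM.adjacencyMatrix (G ω)) lam
                (SBM.partitionMatrix φ)} := by
  intro c hc
  refine ⟨16 * Real.exp 8 / c, by positivity, fun n φ p q hsize hq _ hp0 hp1 hgap =>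
    ⟨(p + q) / 2, fun Ω _ μ _ G hG => ?_⟩⟩
  rcases Nat.eq_zero_or_pos n with rfl | hn
  -- For `n = 0` the convention `0 ^ (-10) = 0` makes the claimed bound equal to one; it holds
  -- because there is only one matrix of size zero.
  · have huniv : {ω | SBM.IsUniqueSDPSolution (SBM.adjacencyMatrix (G ω)) ((p + q) / 2)
        (SBM.partitionMatrix φ)} = Set.univ := by
      refine Set.eq_univ_of_forall fun ω => ⟨⟨SBM.partitionMatrix_mem_sdpFeasible φ, fun Y _ => ?_⟩,
        fun Y _ => Subsingleton.elim _ _⟩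
      rw [Subsingleton.elim Y (SBM.partitionMatrix φ)]
    rw [huniv, MeasureTheory.probReal_univ]
    norm_num
  rcases Nat.eq_or_lt_of_le (Nat.succ_le_of_lt hn) with h1 | hn2
  -- For `n = 1` the claimed bound is `1 - 10 < 0`.
  · refine le_trans ?_ MeasureTheory.measureReal_nonneg
    rw [← h1]
    norm_num
  have hn' : (0 : ℝ) < n := by exact_mod_cast hn
  have hn2' : (2 : ℝ) ≤ n := by exact_mod_cast hn2
  have hL : 1 / 2 ≤ Real.log n := by
    have h1 := Real.log_le_log (by norm_num) hn2'
    have h2 := Real.log_two_gt_d9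
    linarith
  have hs0 : 0 ≤ 16 * Real.exp 8 / c * Real.sqrt (p * Real.log n / n) := by positivity
  have hc1 : c ≤ 1 := by
    have h1 : (SBM.clusterSize φ 0 : ℝ) ≤ n := by
      exact_mod_cast (Finset.card_le_univ _).trans (by simp)
    have h2 : c * n ≤ 1 * n := by linarith [hsize 0]
    exact le_of_mul_le_mul_right h2 hn'
  have hsq : (16 * Real.exp 8 / c) ^ 2 * (p * Real.log n) ≤ n * (p - q) ^ 2 := by
    have h1 := pow_le_pow_left₀ hs0 hgap.le 2
    rw [mul_pow, Real.sq_sqrt (by positivity), ← mul_div_assoc, div_le_iff₀ hn'] at h1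
    linarith
  refine le_trans ?_ (hG.one_sub_le_measureReal_isUnique hc hc1 hn hsize hq hp1
    (by linarith) hL hsq)
  -- With `r = 2` the failure probability is at most `5 * n * n ^ (-12)`. Splitting off `n ^ (-2)`
  -- absorbs the factor `n`, leaving at most `5 * n ^ (-10)`.
  have hexp : Real.exp (-12 * Real.log n) = (n : ℝ) ^ (-10 : ℤ) * ((n : ℝ) ^ 2)⁻¹ := by
    have h1 : -12 * Real.log n = -((12 : ℕ) * Real.log n) := by push_cast; ring
    rw [h1, Real.exp_neg, Real.exp_nat_mul, Real.exp_log hn', zpow_neg, ← mul_inv]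
    congr 1
    norm_cast
    rw [← pow_add]
  have hle : (n : ℝ) * ((n : ℝ) ^ 2)⁻¹ ≤ 1 := by
    rw [← div_eq_mul_inv, div_le_one (by positivity)]
    nlinarith
  rw [hexp]
  have hpos : 0 ≤ (n : ℝ) ^ (-10 : ℤ) := by positivity
  have := mul_le_mul_of_nonneg_left hle hpos
  push_cast
  linarith
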